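/- Let $X$ be a Dedekind complete Riesz space (real vector lattice). Let $X^s$ be its sup-completion: the set of nonempty upward directed subsets of $X$ modulo the equivalence $A\sim A'$ iff $\sup_{a\in A}(x\wedge a)=\sup_{a'\in A'}(x\wedge a')$ for all $x\in X$, with addition induced by $A+A'=\{a+a'\}$, with $[A]\le[A']$ iff $\sup_{a\in A}(x\wedge a)\le\sup_{a'\in A'}(x\wedge a')$ for all $x\in X$, and with $X\subseteq X^s$ via $x\mapsto[\{x\}]$; put $X^s_+=\{x\in X^s: x\ge 0\}$. Let $X^u$ be the universal completion of $X$, that is, a Dedekind complete and laterally complete Riesz space containing $X$ as an order dense Riesz subspace. An element $u\in X^u$ and an element $y\in X^s$ are identified when they dominate the same elements of $X$; in particular, $X^u_+\subseteq X^s_+$, each $u\in X^u_+$ being identified with $\sup\{a\in X: a\le u\}\in X^s$. For a projection band $B$ of $X$, let $\infty_B\in X^s$ denote the greatest element of $B^s=\{\sup A:\emptyset\ne A\subseteq B\}\subseteq X^s$ (suprema taken in $X^s$). Then for every $x\in X^s_+$ there are a projection band $B$ of $X$ and an element $u\in X^u_+$ with $u$ disjoint from $B$ in $X^u$ (that is,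 $|u|\wedge|b|=0$ for all $b\in B$) such that $$x=\infty_B+u \quad\text{in } X^s,$$ and both $B$ and $u$ are unique: if $x=\infty_{B'}+u'$ with a projection band $B'$ of $X$ and an element $u'\in X^u$ that also lies in $X^s$ and is disjoint from $B'$, then $B'=B$ and $u'=u$. (The elements $x^\infty=\infty_B$ and $x^f=u$ are called the infinite part and the finite part of $x$.) -/

import Mathlib

open scoped Pointwise

namespace SupCompletion

section Basic

variable (X : Type*) [AddCommGroup X] [ConditionallyCompleteLattice X]

/-- Nonempty upward directed subsets of `X`. -/
structure UpDirected where
  carrier : Set X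
  nonempty : carrier.Nonempty
  directed : DirectedOn (· ≤ ·) carrier

variable {X}

/-- `trunc x A = sup {x ⊓ a | a ∈ A}`, the supremum of a nonempty set bounded above by `x`. -/
noncomputable def trunc (x : X) (A : UpDirected X) : X :=
  sSup ((fun a => x ⊓ a) '' A.carrier)

theorem isLUB_trunc (x : X) (A : UpDirected X) :
    IsLUB ((fun a => x ⊓ a) '' A.carrier) (trunc x A) :=
  isLUB_csSup (A.nonempty.image _) ⟨x, by rintro _ ⟨a, -, rfl⟩; exact inf_le_left⟩

theorem trunc_le_self (x : X) (A : UpDirected X) : trunc x A ≤ x :=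
  (isLUB_trunc x A).2 (by rintro _ ⟨a, -, rfl⟩; exact inf_le_left)

theorem inf_le_trunc (x : X) {A : UpDirected X} {a : X} (ha : a ∈ A.carrier) :
    x ⊓ a ≤ trunc x A :=
  (isLUB_trunc x A).1 ⟨a, ha, rfl⟩

theorem trunc_le {x c : X} {A : UpDirected X} (h : ∀ a ∈ A.carrier, x ⊓ a ≤ c) :
    trunc x A ≤ c :=
  (isLUB_trunc x A).2 (by rintro _ ⟨a, ha, rfl⟩; exact h a ha)

/-- Two directed sets are equivalent when all their truncations have the same supremum. -/
instance setoid : Setoid (UpDirected X) where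
  r A B := ∀ x : X, trunc x A = trunc x B
  iseqv := ⟨fun _ _ => rfl, fun h x => (h x).symm, fun h k x => (h x).trans (k x)⟩

variable (X) in
/-- The sup-completion `X^s` of a Dedekind complete Riesz space `X`. -/
def Xs : Type _ := Quotient (setoid (X := X))

/-- The class of a directed set. -/
def Xs.mk (A : UpDirected X) : Xs X := Quotient.mk _ A

/-- The order of `X^s`: comparison of the suprema of all truncations. -/
instance : PartialOrder (Xs X) where
  le p q := Quotient.liftOn₂ p q (fun A B => ∀ x : X, trunc x A ≤ trunc x B)
    (fun A B A' B' hA hB => propext <| forall_congr' fun x => by rw [hA x, hB x])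
  le_refl p := by
    induction p using Quotient.ind
    exact fun x => le_rfl
  le_trans p q r := by
    induction p using Quotient.ind
    induction q using Quotient.ind
    induction r using Quotient.ind
    exact fun h k x => (h x).trans (k x)
  le_antisymm p q := by
    induction p using Quotient.ind
    induction q using Quotient.ind
    exact fun h k => Quotient.sound fun x => le_antisymm (h x) (k x)

theorem Xs.mk_le_mk {A B : UpDirected X} :
    Xs.mk A ≤ Xs.mk B ↔ ∀ x : X, trunc x A ≤ trunc x B := Iff.rfl

/-- A one-point set as a directed set. -/
def UpDirected.single (x : X) : UpDirected X where
  carrier := {x}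
  nonempty := Set.singleton_nonempty x
  directed := by
    rintro a rfl b rfl
    exact ⟨b, rfl, le_rfl, le_rfl⟩

/-- The embedding of `X` into `X^s`: `x` is the class of `{x}`. -/
def Xs.of (x : X) : Xs X := Xs.mk (UpDirected.single x)

variable [IsOrderedAddMonoid X]

/-- The sum `{a + b | a ∈ A, b ∈ B}` of two directed sets. -/
def UpDirected.add (A B : UpDirected X) : UpDirected X where
  carrier := A.carrier + B.carrier
  nonempty := A.nonempty.add B.nonempty
  directed := by
    rintro _ ⟨a, ha, b, hb, rfl⟩ _ ⟨a', ha', b', hb', rfl⟩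
    obtain ⟨c, hc, h1, h2⟩ := A.directed a ha a' ha'
    obtain ⟨d, hd, h3, h4⟩ := B.directed b hb b' hb'
    exact ⟨c + d, ⟨c, hc, d, hd, rfl⟩, add_le_add h1 h3, add_le_add h2 h4⟩

theorem le_of_trunc_self {A B : UpDirected X} (h : ∀ a ∈ A.carrier, a ≤ trunc a B) (x : X) :
    trunc x A ≤ trunc x B := by
  refine trunc_le fun a ha => ?_
  have e : ∀ b : X, x ⊓ b = x + b - x ⊔ b := fun b => by
    rw [eq_sub_iff_add_eq, inf_add_sup]
  have key : trunc a B ≤ trunc x B - x + x ⊔ a := by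
    refine trunc_le fun b hb => ?_
    have h1 : x ⊓ (a ⊓ b) ≤ trunc x B :=
      (inf_le_inf_left x inf_le_right).trans (inf_le_trunc x hb)
    rw [e] at h1
    have h2 : x ⊔ (a ⊓ b) ≤ x ⊔ a := sup_le_sup_left inf_le_left x
    have h3 : a ⊓ b = (x + a ⊓ b - x ⊔ (a ⊓ b)) - x + x ⊔ (a ⊓ b) := by abel
    rw [h3]
    exact add_le_add (sub_le_sub_right h1 x) h2
  have h4 := (h a ha).trans key
  rw [e]
  calc x + a - x ⊔ a ≤ x + (trunc x B - x + x ⊔ a) - x ⊔ a :=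
        sub_le_sub_right (add_le_add_right h4 x) _
    _ = trunc x B := by abel

theorem self_le_trunc {A B : UpDirected X} (h : ∀ x, trunc x A ≤ trunc x B) {a : X}
    (ha : a ∈ A.carrier) : a ≤ trunc a B :=
  (by simpa using inf_le_trunc a ha : a ≤ trunc a A).trans (h a)

theorem add_mono_aux {A A' B B' : UpDirected X} (hA : ∀ x, trunc x A ≤ trunc x A')
    (hB : ∀ x, trunc x B ≤ trunc x B') (x : X) :
    trunc x (A.add B) ≤ trunc x (A'.add B') := by
  refine le_of_trunc_self ?_ x
  rintro _ ⟨a, ha, b, hb, rfl⟩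
  have h1 : trunc a A' + trunc b B' ≤ trunc (a + b) (A'.add B') := by
    rw [← le_sub_iff_add_le]
    refine trunc_le fun a' ha' => ?_
    rw [le_sub_iff_add_le, ← le_sub_iff_add_le']
    refine trunc_le fun b' hb' => ?_
    rw [le_sub_iff_add_le']
    exact (le_inf (add_le_add inf_le_left inf_le_left)
      (add_le_add inf_le_right inf_le_right)).trans
        (inf_le_trunc (a + b) (A := A'.add B') ⟨a', ha', b', hb', rfl⟩)
  exact (add_le_add (self_le_trunc hA ha) (self_le_trunc hB hb)).trans h1

/-- Addition of `X^s`, induced by addition of directed sets. -/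
instance : Add (Xs X) where
  add := Quotient.map₂ UpDirected.add (by
    intro A A' hA B B' hB x
    exact le_antisymm (add_mono_aux (fun y => (hA y).le) (fun y => (hB y).le) x)
      (add_mono_aux (fun y => (hA y).ge) (fun y => (hB y).ge) x))

end Basic

section Bands

variable (X : Type*) [AddCommGroup X] [ConditionallyCompleteLattice X] [IsOrderedAddMonoid X]
  [Module ℝ X] [IsOrderedModule ℝ X]

/-- A projection band: a solid linear subspace `B`, closed under all suprema existing in `X`,
with `X = B + B^d`, where `B^d` is the set of elements disjoint from `B`. -/
@[ext]
structure ProjectionBand extends Submodule ℝ X where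
  solid : ∀ x y : X, |x| ≤ |y| → y ∈ carrier → x ∈ carrier
  sup_mem : ∀ (A : Set X) (s : X), A.Nonempty → A ⊆ carrier → IsLUB A s → s ∈ carrier
  decomp : ∀ x : X, ∃ b ∈ carrier, ∃ c : X, (∀ d ∈ carrier, |c| ⊓ |d| = 0) ∧ x = b + c

variable {X}

/-- A projection band is itself an upward directed set. -/
def ProjectionBand.toUpDirected (B : ProjectionBand X) : UpDirected X where
  carrier := B.carrier
  nonempty := ⟨0, B.zero_mem'⟩
  directed := fun x hx y hy =>
    ⟨x ⊔ y, B.sup_mem {x, y} (x ⊔ y) (Set.insert_nonempty _ _)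
      (by rintro z (rfl | rfl) <;> assumption) isLUB_pair, le_sup_left, le_sup_right⟩

/-- The sup-completion `B^s` inside `X^s`: all suprema of nonempty subsets of `B`. -/
def ProjectionBand.supCompletion (B : ProjectionBand X) : Set (Xs X) :=
  {y | ∃ A : Set X, A.Nonempty ∧ A ⊆ B.carrier ∧ IsLUB (Xs.of '' A) y}

/-- `∞_B`, the greatest element of `B^s` (see `isGreatest_infty`). -/
def ProjectionBand.infty (B : ProjectionBand X) : Xs X := Xs.mk B.toUpDirected

theorem Xs.isLUB_mk (A : UpDirected X) : IsLUB (Xs.of '' A.carrier) (Xs.mk A) := by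
  constructor
  · rintro _ ⟨a, ha, rfl⟩
    intro x
    refine trunc_le fun b hb => ?_
    obtain rfl : b = a := hb
    exact inf_le_trunc x ha
  · intro y hy
    induction y using Quotient.ind with
    | _ C =>
      intro x
      refine trunc_le fun a ha => ?_
      have h : Xs.of a ≤ Xs.mk C := hy ⟨a, ha, rfl⟩
      exact (inf_le_trunc x (A := UpDirected.single a) rfl).trans (h x)

theorem ProjectionBand.isGreatest_infty (B : ProjectionBand X) :
    IsGreatest B.supCompletion B.infty := by
  refine ⟨⟨B.carrier, ⟨0, B.zero_mem'⟩, subset_rfl, Xs.isLUB_mk B.toUpDirected⟩, ?_⟩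
  rintro y ⟨A, -, hA, hy⟩
  exact hy.2 fun z hz => (Xs.isLUB_mk B.toUpDirected).1 (Set.image_mono hA hz)

end Bands

section Universal

variable {X : Type*} [AddCommGroup X] [ConditionallyCompleteLattice X] [IsOrderedAddMonoid X]
  [Module ℝ X] [IsOrderedModule ℝ X]
variable {U : Type*} [AddCommGroup U] [ConditionallyCompleteLattice U] [IsOrderedAddMonoid U]
  [Module ℝ U] [IsOrderedModule ℝ U]

/-- The Dedekind complete Riesz space `U` is, through `j`, the universal completion `X^u` of `X`:
it is laterally complete (hence universally complete), and `j` is a Riesz isomorphism of `X` onto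
an order dense Riesz subspace of `U`. -/
structure IsUniversalCompletion (j : X →ₗ[ℝ] U) : Prop where
  laterally_complete : ∀ D : Set U, D.Nonempty → (∀ a ∈ D, 0 ≤ a) →
    (∀ a ∈ D, ∀ b ∈ D, a ≠ b → a ⊓ b = 0) → ∃ s : U, IsLUB D s
  map_sup : ∀ x y : X, j (x ⊔ y) = j x ⊔ j y
  injective : Function.Injective j
  order_dense : ∀ u : U, 0 < u → ∃ x : X, 0 < j x ∧ j x ≤ u

/-- `y ∈ X^s` and `u ∈ X^u` are the same element, that is, they dominate the same elements
of `X` (both are determined by these). Every `u ≥ 0` in `X^u` is in this way the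
element `sup {a ∈ X | a ≤ u}` of `X^s`. -/
def Same (j : X →ₗ[ℝ] U) (y : Xs X) (u : U) : Prop :=
  ∀ a : X, Xs.of a ≤ y ↔ j a ≤ u

/-- `x = ∞_B + u`, where `u ∈ X^u` (lying also in `X^s`) is disjoint from `B` in `X^u`. -/
def IsDecomposition (j : X →ₗ[ℝ] U) (x : Xs X) (B : ProjectionBand X) (u : U) : Prop :=
  (∀ b ∈ B.carrier, |u| ⊓ |j b| = 0) ∧ ∃ y : Xs X, Same j y u ∧ x = B.infty + y

end Universal

end SupCompletion

/-!
An element `z ≥ 0` of `X^s` is determined by the set of elements of `X` it dominates, which is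
closed under minorants and existing suprema. The `b` with `n|b| ≤ z` for all `n` form a band `B`
(`infiniteBand`), a projection band since `X` is Dedekind complete. Splitting `a ≤ z` with `a ≥ 0`
into its components in `B` and in `B^d` gives `z = ∞_B + y`, where `y` is the supremum of the
positive elements of `B^d` below `z` (`eq_infty_add_finitePart`).

The main point is that these elements are bounded above in `U`, so that `y` is an element of `U`.
Below every positive element of `B^d` there is, up to a multiple, some `w > 0` on whose band they
are bounded: if `p = n x` is not below `z`, take `w = p - z ⊓ p` (`bddAbove_finitePart`). Over a
maximal disjoint family of such `w` the local bounds are disjoint, and lateral completeness glues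
them to a global one (`bddAbove_of_locally_bddAbove`).

Uniqueness rests on `IsDecomposition.of_add_le_iff`: if `z = ∞_B + u` with `u` disjoint from `B`,
then, for `b ∈ B` and `c ∈ B^d`, `b + c ≤ z` if and only if `c ≤ u`. Since `U` is Archimedean, `B`
can be recovered from `z`, and since `X` is order dense in `U`, so can `u`.
-/

namespace SupCompletion

/-! ### Lattice ordered groups -/

section LatticeGroup

variable {G : Type*} [AddCommGroup G] [Lattice G] [IsOrderedAddMonoid G]

theorem inf_add_le_inf_add_inf {a b c : G} (ha : 0 ≤ a) (hb : 0 ≤ b) (hc : 0 ≤ c) :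
    a ⊓ (b + c) ≤ a ⊓ b + a ⊓ c := by
  have h0 : 0 ≤ a ⊓ c := le_inf ha hc
  rw [← sub_le_iff_le_add]
  refine le_inf ?_ ?_
  · exact (sub_le_self _ h0).trans inf_le_left
  · rw [sub_le_iff_le_add', ← sub_le_iff_le_add]
    refine le_inf ((sub_le_self _ hb).trans inf_le_left) ?_
    rw [sub_le_iff_le_add']
    exact inf_le_right

theorem inf_nsmul_eq_zero {a b : G} (ha : 0 ≤ a) (hb : 0 ≤ b) (h : a ⊓ b = 0) (n : ℕ) :
    a ⊓ n • b = 0 := by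
  induction n with
  | zero => simpa using ha
  | succ n ih =>
    refine le_antisymm ?_ (le_inf ha (nsmul_nonneg hb _))
    rw [succ_nsmul]
    refine (inf_add_le_inf_add_inf ha (nsmul_nonneg hb n) hb).trans ?_
    rw [ih, h, add_zero]

theorem inf_eq_zero_of_le {a b c d : G} (ha : 0 ≤ a) (hb : 0 ≤ b) (hac : a ≤ c) (hbd : b ≤ d)
    (h : c ⊓ d = 0) : a ⊓ b = 0 :=
  le_antisymm ((inf_le_inf hac hbd).trans h.le) (le_inf ha hb)

theorem abs_sub_inf_abs_eq_zero {a b d : G} (ha : |a| ⊓ |d| = 0) (hb : |b| ⊓ |d| = 0) :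
    |a - b| ⊓ |d| = 0 := by
  refine inf_eq_zero_of_le (abs_nonneg _) (abs_nonneg _) (c := |a| + |b|) ?_ le_rfl ?_
  · rw [sub_eq_add_neg]
    simpa using abs_add_le a (-b)
  · refine le_antisymm ?_ (le_inf (add_nonneg (abs_nonneg _) (abs_nonneg _)) (abs_nonneg _))
    rw [inf_comm]
    refine (inf_add_le_inf_add_inf (abs_nonneg _) (abs_nonneg _) (abs_nonneg _)).trans ?_
    rw [inf_comm, ha, inf_comm, hb, add_zero]

theorem add_le_two_nsmul_sup (p q : G) : p + q ≤ 2 • p ⊔ 2 • q := by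
  -- The difference of the two sides is `|p - q|`.
  have e : 2 • p ⊔ 2 • q - (p + q) = |p - q| := by
    rw [sup_sub, abs, two_nsmul, two_nsmul]
    congr 1 <;> abel
  rw [← sub_nonneg, e]
  exact abs_nonneg _

theorem sub_inf_inf_sub_inf (a p : G) : (a - a ⊓ p) ⊓ (p - a ⊓ p) = 0 := by
  rw [← inf_sub, sub_self]

/-- Existing suprema distribute over binary infima in a lattice ordered group. -/
theorem inf_le_of_isLUB {S : Set G} {m a c : G} (hm : IsLUB S m) (h : ∀ s ∈ S, a ⊓ s ≤ c) :
    a ⊓ m ≤ c := by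
  have e : ∀ b : G, a ⊓ b = a + b - a ⊔ b := fun b => by
    rw [eq_sub_iff_add_eq, inf_add_sup]
  have key : m ≤ c - a + a ⊔ m := by
    refine hm.2 fun s hs => ?_
    have h1 := h s hs
    rw [e] at h1
    calc s = (a + s - a ⊔ s) - a + a ⊔ s := by abel
      _ ≤ c - a + a ⊔ m :=
        add_le_add (sub_le_sub_right h1 a) (sup_le_sup_left (hm.1 hs) a)
  rw [e]
  calc a + m - a ⊔ m ≤ a + (c - a + a ⊔ m) - a ⊔ m :=
        sub_le_sub_right (add_le_add_right key a) _
    _ = c := by abel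

end LatticeGroup

/-! ### Boundedness in laterally complete spaces -/

section DedekindComplete

variable {U : Type*} [AddCommGroup U] [ConditionallyCompleteLattice U] [IsOrderedAddMonoid U]

/-- A Dedekind complete lattice ordered group is Archimedean. -/
theorem nonpos_of_nsmul_le {t u : U} (h : ∀ n : ℕ, n • t ≤ u) : t ≤ 0 := by
  have hs : IsLUB (Set.range fun n : ℕ => n • t) (sSup (Set.range fun n : ℕ => n • t)) :=
    isLUB_csSup (Set.range_nonempty _) ⟨u, by rintro _ ⟨n, rfl⟩; exact h n⟩
  set s := sSup (Set.range fun n : ℕ => n • t)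
  have h1 : s ≤ s - t := hs.2 (by
    rintro _ ⟨n, rfl⟩
    rw [le_sub_iff_add_le]
    have := hs.1 ⟨n + 1, rfl⟩
    simpa [succ_nsmul] using this)
  exact (le_sub_self_iff s).1 h1

/-- In a laterally complete space, a set `D` of positive elements is bounded above as soon as
below every positive minorant `r` of an element of `D` there is, up to a multiple, some `w > 0` for
which `D` is bounded on the band generated by `w`. The bounds over a maximal disjoint family of such
`w` are themselves disjoint, and their supremum bounds `D`. -/
theorem bddAbove_of_locally_bddAbove
    (lat : ∀ D : Set U, D.Nonempty → (∀ a ∈ D, 0 ≤ a) →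
      (∀ a ∈ D, ∀ b ∈ D, a ≠ b → a ⊓ b = 0) → ∃ s : U, IsLUB D s)
    {D : Set U} (hne : D.Nonempty) (hD : ∀ a ∈ D, 0 ≤ a)
    (h : ∀ r : U, 0 < r → (∃ a ∈ D, r ≤ a) → ∃ w : U, 0 < w ∧ (∃ n : ℕ, w ≤ n • r) ∧
      BddAbove {z | ∃ a ∈ D, ∃ k : ℕ, z = a ⊓ k • w}) : BddAbove D := by
  let T : U → Set U := fun w => {z | ∃ a ∈ D, ∃ k : ℕ, z = a ⊓ k • w}
  have hTne : ∀ w, (T w).Nonempty := fun w => let ⟨a, ha⟩ := hne; ⟨_, a, ha, 0, rfl⟩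
  obtain ⟨S, hS⟩ := zorn_subset
    {S : Set U | (∀ w ∈ S, 0 < w ∧ BddAbove (T w)) ∧ S.Pairwise fun a b => a ⊓ b = 0} (by
      intro c hc hchain
      refine ⟨⋃₀ c, ⟨?_, ?_⟩, fun s hs => Set.subset_sUnion_of_mem hs⟩
      · rintro w ⟨s, hs, hw⟩
        exact (hc hs).1 w hw
      · rw [Set.pairwise_sUnion hchain.directedOn]
        exact fun s hs => (hc hs).2)
  obtain ⟨hSG, hSd⟩ := hS.prop
  have hlub : ∀ w ∈ S, IsLUB (T w) (sSup (T w)) := fun w hw =>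
    isLUB_csSup (hTne w) (hSG w hw).2
  have hnn : ∀ w ∈ S, 0 ≤ sSup (T w) := fun w hw => by
    obtain ⟨a, ha⟩ := hne
    refine (hlub w hw).1 ⟨a, ha, 0, ?_⟩
    simp [hD a ha]
  have hdisj : ∀ w ∈ S, ∀ w' ∈ S, w ≠ w' → sSup (T w) ⊓ sSup (T w') = 0 := by
    intro w hw w' hw' hww
    refine le_antisymm ?_ (le_inf (hnn w hw) (hnn w' hw'))
    refine inf_le_of_isLUB (hlub w' hw') ?_
    rintro _ ⟨a', ha', k', rfl⟩
    rw [inf_comm]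
    refine inf_le_of_isLUB (hlub w hw) ?_
    rintro _ ⟨a, ha, k, rfl⟩
    refine (inf_le_inf inf_le_right inf_le_right).trans ?_
    have h1 := inf_nsmul_eq_zero (hSG w hw).1.le (hSG w' hw').1.le (hSd hw hw' hww) k'
    rw [inf_comm] at h1
    exact (inf_nsmul_eq_zero (nsmul_nonneg (hSG w' hw').1.le k') (hSG w hw).1.le h1 k).le
  obtain ⟨v, hv⟩ := lat (insert 0 ((fun w => sSup (T w)) '' S)) ⟨0, Or.inl rfl⟩ (by
      rintro a (rfl | ⟨w, hw, rfl⟩)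
      exacts [le_rfl, hnn w hw]) (by
      rintro a (rfl | ⟨w, hw, rfl⟩) b (rfl | ⟨w', hw', rfl⟩) hab
      · exact absurd rfl hab
      · exact inf_eq_left.2 (hnn w' hw')
      · exact inf_eq_right.2 (hnn w hw)
      · exact hdisj w hw w' hw' fun e => hab (by rw [e]))
  refine ⟨v, fun a ha => ?_⟩
  by_contra hav
  have hr : 0 < a - a ⊓ v := by
    refine lt_of_le_of_ne (sub_nonneg.2 inf_le_left) fun e => hav ?_
    exact inf_eq_left.1 (sub_eq_zero.1 e.symm).symm
  have hv0 : 0 ≤ v := hv.1 (Or.inl rfl)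
  obtain ⟨w, hw0, ⟨n, hwn⟩, hwb⟩ := h _ hr ⟨a, ha, sub_le_self _ (le_inf (hD a ha) hv0)⟩
  -- By maximality some member of `S` meets `w`, hence meets the excess of `a` over `v`.
  obtain ⟨w₀, hw₀, hne₀⟩ : ∃ w₀ ∈ S, w₀ ⊓ w ≠ 0 := by
    by_contra! hcon
    have hmem : w ∈ S := by
      refine hS.le_of_ge (y := insert w S) ⟨?_, ?_⟩ (Set.subset_insert _ _) (Set.mem_insert _ _)
      · rintro y (rfl | hy)
        exacts [⟨hw0, hwb⟩, hSG y hy]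
      · refine hSd.insert fun b hb _ => ⟨?_, hcon b hb⟩
        rw [inf_comm]
        exact hcon b hb
    have := hcon w hmem
    rw [inf_idem] at this
    exact hw0.ne' this
  have hw₀0 := (hSG w₀ hw₀).1.le
  set r := a - a ⊓ v with hrdef
  have ht : w₀ ⊓ r ≠ 0 := fun e => hne₀
    (inf_eq_zero_of_le hw₀0 hw0.le le_rfl hwn (inf_nsmul_eq_zero hw₀0 hr.le e n))
  have ht0 : 0 ≤ w₀ ⊓ r := le_inf hw₀0 hr.le
  have hk : ∀ k : ℕ, k • (w₀ ⊓ r) ≤ a := by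
    intro k
    induction k with
    | zero => simpa using hD a ha
    | succ k ih =>
      have h1 : k • (w₀ ⊓ r) ≤ a ⊓ k • w₀ := le_inf ih (nsmul_le_nsmul_right inf_le_left k)
      have h2 : a ⊓ k • w₀ ≤ v :=
        ((hlub w₀ hw₀).1 ⟨a, ha, k, rfl⟩).trans (hv.1 (Or.inr ⟨w₀, hw₀, rfl⟩))
      have h3 : k • (w₀ ⊓ r) ≤ a ⊓ v := le_inf ih (h1.trans h2)
      rw [succ_nsmul]
      calc k • (w₀ ⊓ r) + w₀ ⊓ r ≤ a ⊓ v + r := add_le_add h3 inf_le_right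
        _ = a := by rw [hrdef]; abel
  exact ht (le_antisymm (nonpos_of_nsmul_le hk) ht0)

end DedekindComplete

/-! ### The order of the sup-completion -/

section Order

variable {X : Type*} [AddCommGroup X] [ConditionallyCompleteLattice X]

theorem trunc_mono {x y : X} (h : x ≤ y) (A : UpDirected X) : trunc x A ≤ trunc y A :=
  trunc_le fun _ ha => (inf_le_inf_right _ h).trans (inf_le_trunc y ha)

variable [IsOrderedAddMonoid X]

theorem Xs.of_le_mk {a : X} {C : UpDirected X} : Xs.of a ≤ Xs.mk C ↔ a ≤ trunc a C := by
  refine ⟨fun h => self_le_trunc h rfl, fun h => le_of_trunc_self ?_⟩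
  rintro _ rfl
  exact h

theorem Xs.of_le_of {a b : X} : Xs.of a ≤ Xs.of b ↔ a ≤ b := by
  refine Xs.of_le_mk.trans ⟨fun h => h.trans (trunc_le ?_), fun h => ?_⟩
  · rintro _ rfl
    exact inf_le_right
  · exact (le_inf le_rfl h).trans (inf_le_trunc a rfl)

theorem Xs.of_le_trans {z : Xs X} {a b : X} (h : a ≤ b) (hb : Xs.of b ≤ z) : Xs.of a ≤ z :=
  (Xs.of_le_of.2 h).trans hb

theorem Xs.of_le_of_isLUB {z : Xs X} {S : Set X} {s : X} (hs : IsLUB S s)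
    (h : ∀ a ∈ S, Xs.of a ≤ z) : Xs.of s ≤ z := by
  induction z using Quotient.ind with
  | _ C =>
    refine Xs.of_le_mk.2 (hs.2 fun a ha => ?_)
    exact (Xs.of_le_mk.1 (h a ha)).trans (trunc_mono (hs.1 ha) C)

theorem Xs.of_sup_le {z : Xs X} {a b : X} (ha : Xs.of a ≤ z) (hb : Xs.of b ≤ z) :
    Xs.of (a ⊔ b) ≤ z :=
  Xs.of_le_of_isLUB isLUB_pair (by rintro c (rfl | rfl) <;> assumption)

theorem Xs.of_le_mk_of_mem {a : X} {C : UpDirected X} (ha : a ∈ C.carrier) :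
    Xs.of a ≤ Xs.mk C :=
  Xs.of_le_mk.2 (by simpa using inf_le_trunc a ha)

theorem Xs.mk_le {z : Xs X} {C : UpDirected X} (h : ∀ a ∈ C.carrier, Xs.of a ≤ z) :
    Xs.mk C ≤ z := by
  induction z using Quotient.ind with
  | _ E => exact le_of_trunc_self fun a ha => Xs.of_le_mk.1 (h a ha)

theorem Xs.of_add_le {y z : Xs X} {a b : X} (ha : Xs.of a ≤ y) (hb : Xs.of b ≤ z) :
    Xs.of (a + b) ≤ y + z := by
  induction y using Quotient.ind with
  | _ C =>
    induction z using Quotient.ind with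
    | _ E =>
      have h : Xs.mk ((UpDirected.single a).add (UpDirected.single b)) ≤ Xs.mk (C.add E) :=
        add_mono_aux ha hb
      exact (Xs.of_le_mk_of_mem (C := (UpDirected.single a).add (UpDirected.single b))
        ⟨a, rfl, b, rfl, rfl⟩).trans h

end Order

/-! ### Projection bands and the infinite part -/

section Bands

variable {X : Type*} [AddCommGroup X] [ConditionallyCompleteLattice X] [IsOrderedAddMonoid X]
  [Module ℝ X] [IsOrderedModule ℝ X]

theorem ProjectionBand.exists_nonneg_decomp (B : ProjectionBand X) {x : X} (hx : 0 ≤ x) :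
    ∃ b ∈ B.carrier, ∃ c : X, (∀ d ∈ B.carrier, |c| ⊓ |d| = 0) ∧ 0 ≤ b ∧ 0 ≤ c ∧ x = b + c := by
  obtain ⟨b, hb, c, hc, rfl⟩ := B.decomp x
  refine ⟨b, hb, c, hc, ?_, ?_, rfl⟩
  · have h1 : -b ≤ |c| ⊓ |b| :=
      le_inf ((neg_le_iff_add_nonneg'.2 hx).trans (le_abs_self c)) (neg_le_abs b)
    rw [hc b hb] at h1
    exact neg_nonpos.1 h1
  · have h1 : -c ≤ |c| ⊓ |b| :=
      le_inf (neg_le_abs c) ((neg_le_iff_add_nonneg.2 hx).trans (le_abs_self b))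
    rw [hc b hb] at h1
    exact neg_nonpos.1 h1

theorem ProjectionBand.abs_mem (B : ProjectionBand X) {b : X} (hb : b ∈ B.carrier) :
    |b| ∈ B.carrier :=
  B.solid _ b (by rw [abs_abs]) hb

theorem abs_smul_le_nsmul_abs (r : ℝ) (b : X) {n : ℕ} (hn : |r| ≤ n) : |r • b| ≤ n • |b| := by
  have hr := abs_le.1 hn
  have h1 : 0 ≤ ((n : ℝ) - r) • b⁺ := smul_nonneg (by linarith) (posPart_nonneg b)
  have h2 : 0 ≤ ((n : ℝ) + r) • b⁻ := smul_nonneg (by linarith) (negPart_nonneg b)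
  have h3 : 0 ≤ ((n : ℝ) - r) • b⁻ := smul_nonneg (by linarith) (negPart_nonneg b)
  have h4 : 0 ≤ ((n : ℝ) + r) • b⁺ := smul_nonneg (by linarith) (posPart_nonneg b)
  have e3 : r • b = r • (b⁺ - b⁻) := by rw [posPart_sub_negPart]
  have e2 : |b| = b⁺ + b⁻ := (posPart_add_negPart b).symm
  rw [e2, ← Nat.cast_smul_eq_nsmul ℝ]
  refine sup_le ?_ ?_
  · rw [← sub_nonneg]
    convert add_nonneg h1 h2 using 1
    rw [e3]
    module
  · rw [← sub_nonneg]
    convert add_nonneg h3 h4 using 1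
    rw [e3]
    module

/-- In a Dedekind complete Riesz space every band is a projection band: the component of `x ≥ 0`
in `B` is the supremum of the elements of `B` below `x`. -/
theorem exists_decomp_of_band (B : Submodule ℝ X)
    (solid : ∀ x y : X, |x| ≤ |y| → y ∈ B → x ∈ B)
    (sup_mem : ∀ (A : Set X) (s : X), A.Nonempty → A ⊆ B → IsLUB A s → s ∈ B) (x : X) :
    ∃ b ∈ B, ∃ c : X, (∀ d ∈ B, |c| ⊓ |d| = 0) ∧ x = b + c := by
  have pos : ∀ x : X, 0 ≤ x → ∃ b ∈ B, ∃ c : X, (∀ d ∈ B, |c| ⊓ |d| = 0) ∧ x = b + c := by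
    intro x hx
    have hne : {b | b ∈ B ∧ b ≤ x}.Nonempty := ⟨0, B.zero_mem, hx⟩
    have hp := isLUB_csSup hne ⟨x, fun b hb => hb.2⟩
    set p := sSup {b | b ∈ B ∧ b ≤ x}
    have hpx : p ≤ x := hp.2 fun b hb => hb.2
    have hpB : p ∈ B := sup_mem _ p hne (fun b hb => hb.1) hp
    refine ⟨p, hpB, x - p, fun d hd => ?_, by abel⟩
    have hc : 0 ≤ x - p := sub_nonneg.2 hpx
    rw [abs_of_nonneg hc]
    have h0 : 0 ≤ (x - p) ⊓ |d| := le_inf hc (abs_nonneg d)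
    refine le_antisymm ?_ h0
    have ht : (x - p) ⊓ |d| ∈ B := solid _ d (by rw [abs_of_nonneg h0]; exact inf_le_right) hd
    have h1 : p + (x - p) ⊓ |d| ≤ p := by
      refine hp.1 ⟨B.add_mem hpB ht, ?_⟩
      rw [← le_sub_iff_add_le']
      exact inf_le_left
    exact (add_le_iff_nonpos_right p).1 h1
  obtain ⟨b, hb, c, hc, e⟩ := pos x⁺ (posPart_nonneg x)
  obtain ⟨b', hb', c', hc', e'⟩ := pos x⁻ (negPart_nonneg x)
  refine ⟨b - b', B.sub_mem hb hb', c - c',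
    fun d hd => abs_sub_inf_abs_eq_zero (hc d hd) (hc' d hd), ?_⟩
  rw [← posPart_sub_negPart x, e, e']
  abel

theorem nsmul_posPart_le {z : Xs X} {S : Set X} {s : X} (hne : S.Nonempty) (hs : IsLUB S s)
    (hS : ∀ a ∈ S, ∀ n : ℕ, Xs.of (n • |a|) ≤ z) (n : ℕ) : Xs.of (n • s⁺) ≤ z := by
  have hp : IsLUB ((fun a => a⁺) '' S) s⁺ := by
    refine ⟨?_, fun y hy => ?_⟩
    · rintro _ ⟨a, ha, rfl⟩
      exact posPart_mono (hs.1 ha)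
    · obtain ⟨a, ha⟩ := hne
      have h0 : 0 ≤ y := (posPart_nonneg a).trans (hy ⟨a, ha, rfl⟩)
      exact sup_le (hs.2 fun a ha => (le_posPart a).trans (hy ⟨a, ha, rfl⟩)) h0
  rcases n.eq_zero_or_pos with rfl | hn
  · obtain ⟨a, ha⟩ := hne
    simpa using hS a ha 0
  refine Xs.of_le_of_isLUB (S := (fun a => n • a⁺) '' S) (s := n • s⁺) ?_ ?_
  · have hn' : (0 : ℝ) < n := Nat.cast_pos.2 hn
    refine ⟨?_, fun y hy => ?_⟩
    · rintro _ ⟨a, ha, rfl⟩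
      exact nsmul_le_nsmul_right (hp.1 ⟨a, ha, rfl⟩) n
    · rw [← Nat.cast_smul_eq_nsmul ℝ, ← le_inv_smul_iff_of_pos hn']
      refine hp.2 ?_
      rintro _ ⟨a, ha, rfl⟩
      rw [le_inv_smul_iff_of_pos hn', Nat.cast_smul_eq_nsmul]
      exact hy ⟨a, ha, rfl⟩
  · rintro _ ⟨a, ha, rfl⟩
    refine Xs.of_le_trans (nsmul_le_nsmul_right ?_ n) (hS a ha n)
    exact sup_le (le_abs_self a) (abs_nonneg a)

/-- The band `{b | n|b| ≤ z for all n}` of the elements on which `z ∈ X^s_+` is infinite. -/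
def infiniteBand (z : Xs X) (hz : Xs.of 0 ≤ z) : ProjectionBand X :=
  let B : Submodule ℝ X :=
    { carrier := {b | ∀ n : ℕ, Xs.of (n • |b|) ≤ z}
      zero_mem' := fun n => by simpa using hz
      add_mem' := by
        intro a b ha hb n
        have h1 := Xs.of_sup_le (ha (2 * n)) (hb (2 * n))
        refine Xs.of_le_trans ((nsmul_le_nsmul_right (abs_add_le a b) n).trans ?_) h1
        rw [nsmul_add, mul_nsmul', mul_nsmul']
        exact add_le_two_nsmul_sup _ _
      smul_mem' := by
        intro r b hb n
        obtain ⟨m, hm⟩ := exists_nat_ge |r|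
        refine Xs.of_le_trans ?_ (hb (n * m))
        rw [mul_nsmul']
        exact nsmul_le_nsmul_right (abs_smul_le_nsmul_abs r b hm) n }
  have solid : ∀ x y : X, |x| ≤ |y| → y ∈ B → x ∈ B := fun _ _ hxy hy n =>
    Xs.of_le_trans (nsmul_le_nsmul_right hxy n) (hy n)
  have sup_mem : ∀ (A : Set X) (s : X), A.Nonempty → A ⊆ B → IsLUB A s → s ∈ B := by
    intro A s hne hA hs
    have h1 : s⁺ ∈ B := fun n => by
      rw [abs_of_nonneg (posPart_nonneg s)]
      exact nsmul_posPart_le hne hs (fun a ha => hA ha) n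
    have h2 : s⁻ ∈ B := by
      obtain ⟨a, ha⟩ := hne
      refine solid _ a ?_ (hA ha)
      rw [abs_of_nonneg (negPart_nonneg s)]
      exact (negPart_anti (hs.1 ha)).trans (sup_le (neg_le_abs a) (abs_nonneg a))
    rw [← posPart_sub_negPart s]
    exact B.sub_mem h1 h2
  { B with
    solid := solid
    sup_mem := sup_mem
    decomp := exists_decomp_of_band B solid sup_mem }

theorem mem_infiniteBand {z : Xs X} {hz : Xs.of 0 ≤ z} {b : X} :
    b ∈ (infiniteBand z hz).carrier ↔ ∀ n : ℕ, Xs.of (n • |b|) ≤ z :=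
  Iff.rfl

/-- The positive elements of `X` that are dominated by `z` and disjoint from `B`, as a directed set.
When `B` is the infinite band of `z`, its class in `X^s` is the finite part of `z`. -/
def finitePart (z : Xs X) (hz : Xs.of 0 ≤ z) (B : ProjectionBand X) : UpDirected X where
  carrier := {a | 0 ≤ a ∧ Xs.of a ≤ z ∧ ∀ b ∈ B.carrier, |a| ⊓ |b| = 0}
  nonempty := ⟨0, le_rfl, hz, fun b _ => by simp⟩
  directed := by
    rintro a ⟨ha, haz, had⟩ c ⟨hc, hcz, hcd⟩
    refine ⟨a ⊔ c, ⟨ha.trans le_sup_left, Xs.of_sup_le haz hcz, fun b hb => ?_⟩,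
      le_sup_left, le_sup_right⟩
    have h1 := had b hb
    have h2 := hcd b hb
    rw [abs_of_nonneg ha] at h1
    rw [abs_of_nonneg hc] at h2
    have h0 : 0 ≤ a ⊔ c := ha.trans le_sup_left
    rw [abs_of_nonneg h0]
    refine le_antisymm ?_ (le_inf h0 (abs_nonneg b))
    rw [inf_comm]
    refine inf_le_of_isLUB isLUB_pair ?_
    rintro s (rfl | rfl)
    · rw [inf_comm, h1]
    · rw [inf_comm, h2]

theorem eq_infty_add_finitePart (z : Xs X) (hz : Xs.of 0 ≤ z) :
    z = (infiniteBand z hz).infty + Xs.mk (finitePart z hz (infiniteBand z hz)) := by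
  set B := infiniteBand z hz
  refine le_antisymm ?_ ?_
  · induction z using Quotient.ind with
    | _ C =>
      refine Xs.mk_le fun a ha => ?_
      have hap := Xs.of_sup_le (Xs.of_le_mk_of_mem ha) hz
      obtain ⟨b, hb, c, hc, hb0, hc0, e⟩ := B.exists_nonneg_decomp (le_sup_right : 0 ≤ a ⊔ 0)
      refine Xs.of_le_trans (le_sup_left : a ≤ a ⊔ 0) ?_
      rw [e] at hap ⊢
      exact Xs.of_add_le (Xs.of_le_mk_of_mem hb) (Xs.of_le_mk_of_mem
        ⟨hc0, Xs.of_le_trans (le_add_of_nonneg_left hb0) hap, hc⟩)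
  · refine Xs.mk_le (C := B.toUpDirected.add (finitePart z hz B)) ?_
    rintro _ ⟨b, hb, a, ⟨ha0, haz, had⟩, rfl⟩
    -- As `|b|` and `a` are disjoint, `|b| + a = |b| ⊔ a`.
    have h1 : |b| + a = |b| ⊔ a := by
      rw [← inf_add_sup, inf_comm, ← abs_of_nonneg ha0, had b hb, zero_add]
    refine Xs.of_le_trans (add_le_add_left (le_abs_self b) a) ?_
    rw [h1]
    exact Xs.of_sup_le (by simpa using (mem_infiniteBand (hz := hz)).1 hb 1) haz

end Bands

/-! ### The universal completion and the finite part -/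

section Universal

variable {X : Type*} [AddCommGroup X] [ConditionallyCompleteLattice X] [IsOrderedAddMonoid X]
  [Module ℝ X] [IsOrderedModule ℝ X]
variable {U : Type*} [AddCommGroup U] [ConditionallyCompleteLattice U] [IsOrderedAddMonoid U]
  [Module ℝ U] [IsOrderedModule ℝ U]
variable {j : X →ₗ[ℝ] U}

namespace IsUniversalCompletion

theorem map_le_iff (hj : IsUniversalCompletion j) {a b : X} : j a ≤ j b ↔ a ≤ b := by
  rw [← sup_eq_right, ← hj.map_sup, hj.injective.eq_iff, sup_eq_right]

theorem map_nonneg_iff (hj : IsUniversalCompletion j) {a : X} : 0 ≤ j a ↔ 0 ≤ a := by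
  rw [← hj.map_le_iff, map_zero]

theorem map_inf (hj : IsUniversalCompletion j) (a b : X) : j (a ⊓ b) = j a ⊓ j b := by
  rw [← neg_inj, ← map_neg, neg_inf, neg_inf, hj.map_sup, map_neg, map_neg]

theorem map_abs (hj : IsUniversalCompletion j) (a : X) : j |a| = |j a| := by
  rw [abs, hj.map_sup, map_neg, ← abs]

theorem abs_map_inf_abs_map (hj : IsUniversalCompletion j) {a b : X} (h : |a| ⊓ |b| = 0) :
    |j a| ⊓ |j b| = 0 := by
  rw [← hj.map_abs, ← hj.map_abs, ← hj.map_inf, h, map_zero]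

/-- The embedding into the universal completion preserves existing suprema. -/
theorem isLUB_image (hj : IsUniversalCompletion j) {S : Set X} {a : X} (ha : IsLUB S a) :
    IsLUB (j '' S) (j a) := by
  refine ⟨?_, fun v hv => ?_⟩
  · rintro _ ⟨s, hs, rfl⟩
    exact hj.map_le_iff.2 (ha.1 hs)
  by_contra hav
  have hr : 0 < j a - j a ⊓ v := by
    refine lt_of_le_of_ne (sub_nonneg.2 inf_le_left) fun e => hav ?_
    exact inf_eq_left.1 (sub_eq_zero.1 e.symm).symm
  obtain ⟨x, hx0, hxr⟩ := hj.order_dense _ hr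
  have h1 : a ≤ a - x := ha.2 fun s hs => by
    rw [← hj.map_le_iff, map_sub]
    refine (le_inf (hj.map_le_iff.2 (ha.1 hs)) (hv ⟨s, hs, rfl⟩)).trans ?_
    rwa [le_sub_comm]
  rw [le_sub_self_iff, ← hj.map_le_iff, map_zero] at h1
  exact h1.not_gt hx0

/-- A positive element of the universal completion is determined by the positive elements of `X`
below it. -/
theorem le_of_forall_map_le (hj : IsUniversalCompletion j) {u v : U} (hu : 0 ≤ u)
    (h : ∀ a : X, 0 ≤ a → j a ≤ u → j a ≤ v) : u ≤ v := by
  by_contra huv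
  have hr : 0 < u - u ⊓ v := by
    refine lt_of_le_of_ne (sub_nonneg.2 inf_le_left) fun e => huv ?_
    exact inf_eq_left.1 (sub_eq_zero.1 e.symm).symm
  obtain ⟨x, hx0, hxr⟩ := hj.order_dense _ hr
  have hk : ∀ k : ℕ, k • j x ≤ u := by
    intro k
    induction k with
    | zero => simpa using hu
    | succ k ih =>
      have h1 : k • j x ≤ v := by
        rw [← map_nsmul] at ih ⊢
        exact h _ (nsmul_nonneg (hj.map_nonneg_iff.1 hx0.le) k) ih
      rw [succ_nsmul]
      calc k • j x + j x ≤ u ⊓ v + (u - u ⊓ v) := add_le_add (le_inf ih h1) hxr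
        _ = u := by abel
  exact (nonpos_of_nsmul_le hk).not_gt hx0

end IsUniversalCompletion

/-- If `z = ∞_B + u` with `u` disjoint from `B`, then `z` dominates an element of `X` exactly when
`u` dominates its component disjoint from `B`. This determines `B` and `u`. -/
theorem IsDecomposition.of_add_le_iff (hj : IsUniversalCompletion j) {z : Xs X}
    {B : ProjectionBand X} {u : U} (h : IsDecomposition j z B u) {b c : X} (hb : b ∈ B.carrier)
    (hc : ∀ d ∈ B.carrier, |c| ⊓ |d| = 0) : Xs.of (b + c) ≤ z ↔ j c ≤ u := by
  obtain ⟨hu, y, hy, rfl⟩ := h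
  refine ⟨fun hle => ?_, fun hcu => Xs.of_add_le (Xs.of_le_mk_of_mem hb) ((hy c).2 hcu)⟩
  induction y using Quotient.ind with
  | _ Y =>
    replace hle : Xs.of (b + c) ≤ Xs.mk (B.toUpDirected.add Y) := hle
    rw [Xs.of_le_mk, ← hj.map_le_iff] at hle
    have h1 : j (trunc (b + c) (B.toUpDirected.add Y)) ≤ j b + u := by
      refine (hj.isLUB_image (isLUB_trunc _ _)).2 ?_
      rintro _ ⟨_, ⟨_, ⟨b', hb', a, ha, rfl⟩, rfl⟩, rfl⟩
      have hau : j a ≤ u := (hy a).1 (Xs.of_le_mk_of_mem ha)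
      have hd : b' - b ∈ B.carrier := B.toSubmodule.sub_mem hb' hb
      have hdisj : |j c - u| ⊓ |j (b' - b)| = 0 :=
        abs_sub_inf_abs_eq_zero (hj.abs_map_inf_abs_map (hc _ hd)) (hu _ hd)
      have h2 : (j c - u) ⊓ j (b' - b) ≤ 0 :=
        (inf_le_inf (le_abs_self _) (le_abs_self _)).trans hdisj.le
      have h3 : (j b + j c) ⊓ (j b' + j a) ≤ (j c - u) ⊓ j (b' - b) + (j b + u) := by
        rw [inf_add, map_sub]
        refine inf_le_inf (le_of_eq (by abel)) ?_
        calc j b' + j a ≤ j b' + u := add_le_add_right hau _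
          _ = j b' - j b + (j b + u) := by abel
      rw [hj.map_inf, map_add, map_add]
      exact h3.trans (add_le_of_nonpos_left h2)
    rw [map_add] at hle
    exact le_of_add_le_add_left (hle.trans h1)

theorem IsDecomposition.nonneg (hj : IsUniversalCompletion j) {z : Xs X} (hz : Xs.of 0 ≤ z)
    {B : ProjectionBand X} {u : U} (h : IsDecomposition j z B u) : 0 ≤ u := by
  have := (h.of_add_le_iff hj (b := 0) (c := 0) B.zero_mem' (fun d _ => by simp)).1 (by simpa)
  simpa using this

theorem IsDecomposition.carrier_subset (hj : IsUniversalCompletion j) {z : Xs X} (hz : Xs.of 0 ≤ z)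
    {B B' : ProjectionBand X} {u u' : U} (h : IsDecomposition j z B u)
    (h' : IsDecomposition j z B' u') : B'.carrier ⊆ B.carrier := by
  intro b hb
  obtain ⟨d, hd, c, hc, hd0, hc0, e⟩ := B.exists_nonneg_decomp (abs_nonneg b)
  have hn : ∀ n : ℕ, n • j c ≤ u := by
    intro n
    have h1 : Xs.of (n • |b| + 0) ≤ z :=
      (h'.of_add_le_iff hj (B'.toSubmodule.nsmul_mem (B'.abs_mem hb) n) (fun d _ => by simp)).2
        (by simpa using h'.nonneg hj hz)
    rw [add_zero, e, nsmul_add] at h1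
    rw [← map_nsmul]
    refine (h.of_add_le_iff hj (B.toSubmodule.nsmul_mem hd n) fun d hd => ?_).1 h1
    have h2 := hc d hd
    rw [abs_of_nonneg hc0, inf_comm] at h2
    rw [abs_of_nonneg (nsmul_nonneg hc0 n), inf_comm]
    exact inf_nsmul_eq_zero (abs_nonneg d) hc0 h2 n
  have hc' : c = 0 := by
    refine le_antisymm ?_ hc0
    rw [← hj.map_le_iff, map_zero]
    exact nonpos_of_nsmul_le hn
  rw [hc', add_zero] at e
  exact B.solid b d (by rw [e, abs_of_nonneg hd0]) hd

theorem IsDecomposition.le_of_same_band (hj : IsUniversalCompletion j) {z : Xs X}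
    (hz : Xs.of 0 ≤ z) {B : ProjectionBand X} {u u' : U} (h : IsDecomposition j z B u)
    (h' : IsDecomposition j z B u') : u ≤ u' := by
  have hu0 := h.nonneg hj hz
  refine hj.le_of_forall_map_le hu0 fun a ha hau => ?_
  have had : ∀ d ∈ B.carrier, |a| ⊓ |d| = 0 := fun d hd => by
    have h1 : |j a| ⊓ |j d| = 0 := by
      rw [abs_of_nonneg (hj.map_nonneg_iff.2 ha)]
      exact inf_eq_zero_of_le (hj.map_nonneg_iff.2 ha) (abs_nonneg _)
        (hau.trans (le_abs_self u)) le_rfl (h.1 d hd)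
    rw [← hj.map_abs, ← hj.map_abs, ← hj.map_inf] at h1
    exact hj.injective (h1.trans (map_zero j).symm)
  exact (h'.of_add_le_iff hj B.zero_mem' had).1 ((h.of_add_le_iff hj B.zero_mem' had).2 hau)

theorem IsDecomposition.unique (hj : IsUniversalCompletion j) {z : Xs X} (hz : Xs.of 0 ≤ z)
    {B B' : ProjectionBand X} {u u' : U} (h : IsDecomposition j z B u)
    (h' : IsDecomposition j z B' u') : B' = B ∧ u' = u := by
  have hB : B' = B := ProjectionBand.ext
    (Set.Subset.antisymm (h.carrier_subset hj hz h') (h'.carrier_subset hj hz h))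
  subst hB
  exact ⟨rfl, le_antisymm (h'.le_of_same_band hj hz h) (h.le_of_same_band hj hz h')⟩

/-- A directed set bounded above in the universal completion represents there its supremum. -/
theorem same_mk_of_isLUB (hj : IsUniversalCompletion j) {A : UpDirected X} {u : U}
    (hu : IsLUB (j '' A.carrier) u) : Same j (Xs.mk A) u := by
  intro a
  rw [Xs.of_le_mk]
  refine ⟨fun h => ?_, fun h => ?_⟩
  · refine (hj.map_le_iff.2 h).trans ((hj.isLUB_image (isLUB_trunc a A)).2 ?_)
    rintro _ ⟨_, ⟨c, hc, rfl⟩, rfl⟩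
    refine (hj.map_le_iff.2 inf_le_right).trans (hu.1 ⟨c, hc, rfl⟩)
  · rw [← hj.map_le_iff, ← inf_eq_left.2 h]
    refine inf_le_of_isLUB hu ?_
    rintro _ ⟨c, hc, rfl⟩
    rw [← hj.map_inf, hj.map_le_iff]
    exact inf_le_trunc a hc

/-- Off its infinite band, `z` is bounded in the universal completion. If `x > 0` is disjoint from
the infinite band, some `p = n x` is not dominated by `z`, so `w = p - z ⊓ p > 0`; every `a ≤ z`
satisfies `w ≤ (p - a)⁺`, hence `(a - p)⁺` is disjoint from `w` and `a` is at most `p` on the band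
generated by `w`. -/
theorem bddAbove_finitePart (hj : IsUniversalCompletion j) (z : Xs X) (hz : Xs.of 0 ≤ z) :
    BddAbove (j '' (finitePart z hz (infiniteBand z hz)).carrier) := by
  refine bddAbove_of_locally_bddAbove hj.laterally_complete
    ((finitePart z hz (infiniteBand z hz)).nonempty.image _) ?_ ?_
  · rintro _ ⟨a, ha, rfl⟩
    exact hj.map_nonneg_iff.2 ha.1
  rintro r hr ⟨_, ⟨a₀, ⟨ha₀, -, had₀⟩, rfl⟩, hra⟩
  obtain ⟨x, hx0, hxr⟩ := hj.order_dense r hr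
  have hx : 0 ≤ x := hj.map_nonneg_iff.1 hx0.le
  have hxa : x ≤ a₀ := hj.map_le_iff.1 (hxr.trans hra)
  have hxB : x ∉ (infiniteBand z hz).carrier := fun hmem => by
    have h1 : |x| ⊓ |x| = 0 := inf_eq_zero_of_le (abs_nonneg x) (abs_nonneg x)
      (abs_le_abs_of_nonneg hx hxa) le_rfl (had₀ x hmem)
    rw [inf_idem, abs_of_nonneg hx] at h1
    rw [h1, map_zero] at hx0
    exact lt_irrefl _ hx0
  rw [mem_infiniteBand] at hxB
  push Not at hxB
  obtain ⟨n, hn⟩ := hxB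
  rw [abs_of_nonneg hx] at hn
  induction z using Quotient.ind with
  | _ C =>
    set p := n • x with hp
    have hp0 : 0 ≤ p := nsmul_nonneg hx n
    have hs0 : 0 ≤ trunc p C := (Xs.of_le_mk.1 hz).trans (trunc_mono hp0 C)
    have hw0 : 0 < p - trunc p C := by
      refine lt_of_le_of_ne (sub_nonneg.2 (trunc_le_self p C)) fun e => hn ?_
      exact Xs.of_le_mk.2 (sub_eq_zero.1 e.symm).le
    set w := p - trunc p C with hw
    refine ⟨j w, lt_of_le_of_ne (hj.map_nonneg_iff.2 hw0.le) fun e => hw0.ne ?_, ⟨n, ?_⟩,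
      j p, ?_⟩
    · exact hj.injective ((map_zero j).trans e)
    · refine (hj.map_le_iff.2 (sub_le_self p hs0)).trans ?_
      rw [hp, map_nsmul]
      exact nsmul_le_nsmul_right hxr n
    · rintro _ ⟨_, ⟨a, ⟨ha0, haz, -⟩, rfl⟩, k, rfl⟩
      rw [← map_nsmul, ← hj.map_inf, hj.map_le_iff]
      have hap : a ⊓ p ≤ trunc p C :=
        (Xs.of_le_mk.1 (Xs.of_le_trans inf_le_left haz)).trans (trunc_mono inf_le_right C)
      have h1 : (a - a ⊓ p) ⊓ w = 0 :=
        inf_eq_zero_of_le (sub_nonneg.2 inf_le_left) hw0.le le_rfl (sub_le_sub_left hap p)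
          (sub_inf_inf_sub_inf a p)
      have h2 := inf_nsmul_eq_zero (sub_nonneg.2 inf_le_left) hw0.le h1 k
      have h3 := inf_add_le_inf_add_inf (nsmul_nonneg hw0.le k) (le_inf ha0 hp0)
        (sub_nonneg.2 (inf_le_left : a ⊓ p ≤ a))
      rw [inf_comm (k • w) (a - a ⊓ p), h2, add_zero, add_sub_cancel, inf_comm] at h3
      exact h3.trans (inf_le_right.trans inf_le_right)

theorem exists_isDecomposition (hj : IsUniversalCompletion j) (z : Xs X) (hz : Xs.of 0 ≤ z) :
    ∃ (B : ProjectionBand X) (u : U), IsDecomposition j z B u := by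
  have hne := (finitePart z hz (infiniteBand z hz)).nonempty.image j
  have hu := isLUB_csSup hne (bddAbove_finitePart hj z hz)
  set u := sSup (j '' (finitePart z hz (infiniteBand z hz)).carrier)
  refine ⟨infiniteBand z hz, u, fun b hb => ?_, _, same_mk_of_isLUB hj hu,
    eq_infty_add_finitePart z hz⟩
  have hu0 : 0 ≤ u := by
    obtain ⟨_, a, ha, rfl⟩ := hne
    exact (hj.map_nonneg_iff.2 ha.1).trans (hu.1 ⟨a, ha, rfl⟩)
  rw [abs_of_nonneg hu0]
  refine le_antisymm ?_ (le_inf hu0 (abs_nonneg _))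
  rw [inf_comm]
  refine inf_le_of_isLUB hu ?_
  rintro _ ⟨a, ha, rfl⟩
  have h1 := hj.abs_map_inf_abs_map (ha.2.2 b hb)
  rw [abs_of_nonneg (hj.map_nonneg_iff.2 ha.1), inf_comm] at h1
  exact h1.le

end Universal

end SupCompletion

theorem theorem3p9 {X : Type*} [AddCommGroup X] [ConditionallyCompleteLattice X]
    [IsOrderedAddMonoid X] [Module ℝ X] [IsOrderedModule ℝ X]
    {U : Type*} [AddCommGroup U] [ConditionallyCompleteLattice U]
    [IsOrderedAddMonoid U] [Module ℝ U] [IsOrderedModule ℝ U]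
    (j : X →ₗ[ℝ] U) (hj : SupCompletion.IsUniversalCompletion j)
    (x : SupCompletion.Xs X) (hx : SupCompletion.Xs.of 0 ≤ x) :
    ∃ (B : SupCompletion.ProjectionBand X) (u : U),
      0 ≤ u ∧ SupCompletion.IsDecomposition j x B u ∧
      ∀ (B' : SupCompletion.ProjectionBand X) (u' : U),
        SupCompletion.IsDecomposition j x B' u' → B' = B ∧ u' = u := by 
  obtain ⟨B, u, h⟩ := SupCompletion.exists_isDecomposition hj x hx
  exact ⟨B, u, h.nonneg hj hx, h, fun _ _ h' => h.unique hj hx h'⟩
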